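/- Let $k=(k_1,\dots,k_l)$ be nonnegative integers with $\sum_i k_i=n$, and let $k'=(k'_1,\dots,k'_l)$ be integers with $0\le k'_i\le k_i$, not all zero. There is a unique polynomial $d_{k'}$ with complex coefficients in the entries of $l$ complex $n\times n$ matrices $A_1,\dots,A_l$ such that, whenever $\lambda_{i,1},\dots,\lambda_{i,n}$ are the eigenvalues of $A_i$ with algebraic multiplicity ($1\le i\le l$), $$d_{k'}(A_1,\dots,A_l)=\prod_{F,G}\ \sum_{i=1}^{l}\Bigl(\sum_{j\in F(i)}\lambda_{i,j}-\sum_{j\in G(i)}\lambda_{i,j}\Bigr),$$ where $(F,G)$ runs through all pairs of functions that map each $i\in\{1,\dots,l\}$ to a $k'_i$-element subset of $\{1,\dots,n\}$, with $F(i)\cap G(i)=\emptyset$ for all $i$. The polynomial $d_{k'}$ is invariant under conjugating each $A_i$ by its own invertible matrix. Assume moreover that such pairs $(F,G)$ exist, that is, $2k'_i\le n$ for all $i$ (otherwise the product is empty and $d_{k'}=1$). If $\sum_i k'_i=1$, then $d_{k'}$ is irreducible; put $D_{k'}=d_{k'}$. Otherwise $d_{k'}=D_{k'}^2$ for an irreducible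 polynomial $D_{k'}$ (unique up to sign). If $k'\ne k''$ both satisfy these conditions (for the same $k$), then $D_{k'}$ and $D_{k''}$ are different irreducibles: neither is a constant multiple of the other. -/

import Mathlib

/-- The pairs `(F, G)` of functions sending each `i ∈ [l]` to subsets `F i`, `G i` of `[n]` with
`k' i` elements each, such that `F i` and `G i` are disjoint for all `i`. -/
def disjointSubsetPairs {n l : ℕ} (k' : Fin l → ℕ) :
    Finset ((Fin l → Finset (Fin n)) × (Fin l → Finset (Fin n))) :=
  Finset.univ.filter fun p =>
    ∀ i, (p.1 i).card = k' i ∧ (p.2 i).card = k' i ∧ Disjoint (p.1 i) (p.2 i)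

/-- `∏_{F,G} ∑_i (∑_{j ∈ F(i)} μ_{i,j} - ∑_{j ∈ G(i)} μ_{i,j})`, the product over all pairs of
`disjointSubsetPairs k'`. -/
noncomputable def eigenvalueProduct {n l : ℕ} (k' : Fin l → ℕ) (μ : Fin l → Fin n → ℂ) : ℂ :=
  ∏ p ∈ disjointSubsetPairs (n := n) k',
    ∑ i, (∑ j ∈ p.1 i, μ i j - ∑ j ∈ p.2 i, μ i j)

/-- Polynomials in the entries of `l` complex `n × n` matrices; the variable `(i, a, b)` is the
entry in row `a` and column `b` of the `i`-th matrix. -/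
abbrev EntryPoly (n l : ℕ) : Type := MvPolynomial (Fin l × Fin n × Fin n) ℂ

/-- The value of a polynomial in the entries at an `l`-tuple of matrices. -/
noncomputable def EntryPoly.evalAt {n l : ℕ} (d : EntryPoly n l)
    (A : Fin l → Matrix (Fin n) (Fin n) ℂ) : ℂ :=
  MvPolynomial.eval (fun v => A v.1 v.2.1 v.2.2) d

/-- `μ i 0, …, μ i (n - 1)` are the eigenvalues of `A i`, listed with algebraic multiplicity. -/
def IsEigenvalueList {n l : ℕ} (A : Fin l → Matrix (Fin n) (Fin n) ℂ)
    (μ : Fin l → Fin n → ℂ) : Prop :=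
  ∀ i, (A i).charpoly = ∏ j, (Polynomial.X - Polynomial.C (μ i j))

/-- `d` is the polynomial `d_{k'}`: at all matrices `A_1, …, A_l` its value is the product
`eigenvalueProduct k'` of their eigenvalues. -/
def IsSmallD {n l : ℕ} (k' : Fin l → ℕ) (d : EntryPoly n l) : Prop :=
  ∀ (A : Fin l → Matrix (Fin n) (Fin n) ℂ) (μ : Fin l → Fin n → ℂ),
    IsEigenvalueList A μ → d.evalAt A = eigenvalueProduct k' μ

/-- Invariance under conjugating each of the matrices by its own invertible matrix. -/
def EntryPoly.IsConjInvariant {n l : ℕ} (d : EntryPoly n l) : Prop :=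
  ∀ (A : Fin l → Matrix (Fin n) (Fin n) ℂ) (P : Fin l → (Matrix (Fin n) (Fin n) ℂ)ˣ),
    d.evalAt (fun i => (P i : Matrix (Fin n) (Fin n) ℂ) * A i *
      ((P i)⁻¹ : (Matrix (Fin n) (Fin n) ℂ)ˣ)) = d.evalAt A

/-- `D` is a polynomial `D_{k'}`: it is `d_{k'}` itself if `∑ k'_i = 1`, and a square root of
`d_{k'}` (unique up to sign) otherwise. -/
def IsBigD {n l : ℕ} (k' : Fin l → ℕ) (D : EntryPoly n l) : Prop :=
  ∃ d : EntryPoly n l, IsSmallD k' d ∧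
    ((∑ i, k' i = 1 ∧ D = d) ∨ (∑ i, k' i ≠ 1 ∧ D ^ 2 = d))

open MvPolynomial

/-! The product of the linear forms of all pairs $(F,G)$ is invariant under $S_n^l$, so the
fundamental theorem on symmetric polynomials turns it into a polynomial in the entries.

Factorizations can be studied on diagonal matrices. If $PQ$ is conjugation invariant and nonzero at
$A$, then along a transvection $1+tE_{ab}$ both $P$ and $Q$ are polynomials in $t$ with constant
nonzero product, so $P$ does not change. Transvections and diagonal matrices generate $GL_n$, and
the latter commute with diagonal matrices. Hence $P$ restricts to a block symmetric polynomial on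
diagonal tuples and is constant if that restriction is (`EntryPoly.isBlockSymm_diag`,
`EntryPoly.eq_C_of_diag_eq_C`). So it suffices to exclude nontrivial block symmetric factorizations
(`EntryPoly.IsLift.irreducible`).

On the eigenvalue side every form is prime, $S_n^l$ permutes the forms transitively, and two forms
are associated only for $(F,G)$ and $(G,F)$. Thus the product is $V^2$ with $V$ squarefree
(`halfProd`), and each permutation sends $V$ to $\pm V$. A transposition $(a\,b)$ at $i$ can negate
$V$ only if $X_{i,a}-X_{i,b}$ divides $V$, which forces $k'=e_i$. If $\sum k'_i\ne1$, $V$ is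
therefore symmetric, and by transitivity a symmetric factor containing one form contains all of $V$.
If $\sum k'_i=1$, $V$ is of Vandermonde type and not symmetric, so $V^2$ has no proper symmetric
factor. Finally, a form determines $k'$, which separates the $D_{k'}$. -/

theorem MvPolynomial.eval_aeval_eq {σ τ R : Type*} [CommRing R] (x : τ → R)
    (g : σ → MvPolynomial τ R) (r : MvPolynomial σ R) :
    eval x (aeval g r) = eval (fun i => eval x (g i)) r := by
  induction r using MvPolynomial.induction_on <;> simp_all

/-! ### Symmetric functions of eigenvalues as polynomials in the entries -/

/-- A symmetric polynomial in the eigenvalues is a polynomial in the entries of the matrix. -/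
theorem exists_entryPoly_of_isSymmetric {n : ℕ} {q : MvPolynomial (Fin n) ℂ}
    (hq : q.IsSymmetric) :
    ∃ P : MvPolynomial (Fin n × Fin n) ℂ, ∀ (M : Matrix (Fin n) (Fin n) ℂ) (μ : Fin n → ℂ),
      M.charpoly = ∏ j, (Polynomial.X - Polynomial.C (μ j)) →
      eval (fun v => M v.1 v.2) P = eval μ q := by
  obtain ⟨r, hr⟩ := esymmAlgHom_surjective (σ := Fin n) ℂ (n := n) (by simp) ⟨q, hq⟩
  have hr' : aeval (fun i : Fin n => esymm (Fin n) ℂ (i + 1)) r = q := by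
    rw [← esymmAlgHom_apply, hr]
  -- Vieta: the coefficient of degree $n-(i+1)$ of the characteristic polynomial is
  -- $(-1)^{i+1}e_{i+1}$; the shift comes from indexing $e_1,\dots,e_n$ by `Fin n`.
  refine ⟨aeval (fun i : Fin n => (-1) ^ (i + 1 : ℕ) *
    (Matrix.charpoly.univ ℂ (Fin n)).coeff (n - (i + 1))) r, fun M μ h => ?_⟩
  rw [← hr', eval_aeval_eq, eval_aeval_eq]
  congr 2
  ext i
  have h1 : eval (fun v : Fin n × Fin n => M v.1 v.2)
      ((Matrix.charpoly.univ ℂ (Fin n)).coeff (n - (i + 1))) = M.charpoly.coeff (n - (i + 1)) :=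
    Matrix.charpoly.univ_coeff_eval₂Hom (Fin n) (RingHom.id ℂ) (fun v => M v.1 v.2) _
  have h2 : M.charpoly = ((Finset.univ.val.map μ).map
      fun t => Polynomial.X - Polynomial.C t).prod := by
    rw [h, Multiset.map_map]; rfl
  have hi : n - (n - (i + 1 : ℕ)) = i + 1 := by omega
  rw [map_mul, h1, h2, Multiset.prod_X_sub_C_coeff _ (by simp)]
  simp only [Multiset.card_map, Finset.card_val, Finset.card_univ, Fintype.card_fin, hi, map_pow,
    map_neg, map_one]
  rw [← mul_assoc, ← mul_pow, ← aeval_esymm_eq_multiset_esymm (Fin n) ℂ]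
  simp [aeval_eq_eval]

/-- Polynomials in the eigenvalues of `l` matrices of size `n`. -/
abbrev EigPoly (n l : ℕ) : Type := MvPolynomial (Fin l × Fin n) ℂ

/-- The action of an `l`-tuple of permutations on polynomials in the eigenvalues. -/
noncomputable def EigPoly.perm {n l : ℕ} (w : Fin l → Equiv.Perm (Fin n)) :
    EigPoly n l →ₐ[ℂ] EigPoly n l :=
  rename fun v => (v.1, w v.1 v.2)

/-- Invariance under permuting the eigenvalues of each matrix separately. -/
def EigPoly.IsBlockSymm {n l : ℕ} (p : EigPoly n l) : Prop :=
  ∀ w : Fin l → Equiv.Perm (Fin n), EigPoly.perm w p = p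

theorem EigPoly.eval_perm {n l : ℕ} (w : Fin l → Equiv.Perm (Fin n)) (p : EigPoly n l)
    (x : Fin l × Fin n → ℂ) :
    eval x (perm w p) = eval (fun v => x (v.1, w v.1 v.2)) p := by
  rw [perm, eval_rename]; rfl

/-- A block symmetric polynomial in the eigenvalues is a polynomial in the matrix entries. -/
theorem EigPoly.IsBlockSymm.exists_entryPoly {n l : ℕ} {p : EigPoly n l} (hp : p.IsBlockSymm) :
    ∃ d : EntryPoly n l, ∀ (A : Fin l → Matrix (Fin n) (Fin n) ℂ) (μ : Fin l → Fin n → ℂ),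
      IsEigenvalueList A μ → d.evalAt A = eval (fun v => μ v.1 v.2) p := by
  -- Symmetrized monomials in a single block are handled first; averaging $p$ over $S_n^l$ writes it
  -- as a combination of products of these.
  have key : ∀ e : Fin n → ℕ, ∃ P : MvPolynomial (Fin n × Fin n) ℂ,
      ∀ (M : Matrix (Fin n) (Fin n) ℂ) (μ : Fin n → ℂ),
      M.charpoly = ∏ j, (Polynomial.X - Polynomial.C (μ j)) →
      eval (fun v => M v.1 v.2) P = ∑ σ : Equiv.Perm (Fin n), ∏ j, μ (σ j) ^ e j := by
    intro e
    obtain ⟨P, hP⟩ := exists_entryPoly_of_isSymmetric (n := n)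
      (q := ∑ σ : Equiv.Perm (Fin n), ∏ j, X (σ j) ^ e j) (by
        intro τ
        simp only [map_sum, map_prod, map_pow, rename_X]
        exact Fintype.sum_equiv (Equiv.mulLeft τ) _ _ (fun σ => by simp))
    exact ⟨P, fun M μ h => by rw [hP M μ h]; simp⟩
  choose P hP using key
  let N : ℂ := Fintype.card (Fin l → Equiv.Perm (Fin n))
  have hN : N ≠ 0 := Nat.cast_ne_zero.mpr Fintype.card_ne_zero
  refine ⟨C N⁻¹ * ∑ m ∈ p.support, C (p.coeff m) *
    ∏ i, rename (fun v => (i, v)) (P fun j => m (i, j)), fun A μ h => ?_⟩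
  have h1 : N * eval (fun v => μ v.1 v.2) p =
      ∑ w : Fin l → Equiv.Perm (Fin n), eval (fun v => μ v.1 (w v.1 v.2)) p := by
    have : ∀ w : Fin l → Equiv.Perm (Fin n), eval (fun v : Fin l × Fin n => μ v.1 (w v.1 v.2)) p =
        eval (fun v => μ v.1 v.2) p := fun w => by
      conv_rhs => rw [← hp w, EigPoly.eval_perm]
    simp [this, N]
  have h2 : ∑ w : Fin l → Equiv.Perm (Fin n), eval (fun v => μ v.1 (w v.1 v.2)) p =
      ∑ m ∈ p.support, p.coeff m *
        ∏ i, ∑ σ : Equiv.Perm (Fin n), ∏ j, μ i (σ j) ^ m (i, j) := by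
    simp_rw [eval_eq']
    rw [Finset.sum_comm]
    refine Finset.sum_congr rfl fun m _ => ?_
    -- The sum over tuples of permutations factors into one sum per block.
    rw [← Finset.mul_sum, Fintype.prod_sum]
    simp_rw [Fintype.prod_prod_type]
  rw [EntryPoly.evalAt, map_mul, map_sum, eval_C, inv_mul_eq_iff_eq_mul₀ hN, h1, h2]
  refine Finset.sum_congr rfl fun m _ => ?_
  rw [map_mul, eval_C, map_prod]
  congr 1
  refine Finset.prod_congr rfl fun i _ => ?_
  rw [eval_rename, ← hP _ _ _ (h i)]
  rfl

/-! ### Conjugation and transvections -/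

/-- The tuple of matrices `g_i A_i g_i⁻¹`. -/
def conjTuple {n l : ℕ} (g : Fin l → (Matrix (Fin n) (Fin n) ℂ)ˣ)
    (A : Fin l → Matrix (Fin n) (Fin n) ℂ) : Fin l → Matrix (Fin n) (Fin n) ℂ :=
  fun i => (g i : Matrix (Fin n) (Fin n) ℂ) * A i * ((g i)⁻¹ : (Matrix (Fin n) (Fin n) ℂ)ˣ)

theorem conjTuple_mul {n l : ℕ} (g h : Fin l → (Matrix (Fin n) (Fin n) ℂ)ˣ)
    (A : Fin l → Matrix (Fin n) (Fin n) ℂ) :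
    conjTuple (g * h) A = conjTuple g (conjTuple h A) := by
  ext1 i
  simp [conjTuple, mul_assoc]

theorem conjTuple_one {n l : ℕ} (A : Fin l → Matrix (Fin n) (Fin n) ℂ) :
    conjTuple 1 A = A := by
  ext1 i
  simp [conjTuple]

theorem EntryPoly.IsConjInvariant.evalAt_conjTuple {n l : ℕ} {d : EntryPoly n l}
    (hd : d.IsConjInvariant) (g : Fin l → (Matrix (Fin n) (Fin n) ℂ)ˣ)
    (A : Fin l → Matrix (Fin n) (Fin n) ℂ) : d.evalAt (conjTuple g A) = d.evalAt A :=
  hd A g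

theorem EntryPoly.evalAt_mul {n l : ℕ} (P Q : EntryPoly n l)
    (A : Fin l → Matrix (Fin n) (Fin n) ℂ) :
    EntryPoly.evalAt (P * Q) A = P.evalAt A * Q.evalAt A := by
  simp [EntryPoly.evalAt]

theorem EntryPoly.funext {n l : ℕ} {P Q : EntryPoly n l}
    (h : ∀ A, P.evalAt A = Q.evalAt A) : P = Q :=
  MvPolynomial.funext fun x => h fun i a b => x (i, a, b)

/-- The transvection `1 + c E_{ab}` as a unit. -/
def transvectionUnit {n : ℕ} {a b : Fin n} (hab : a ≠ b) (c : ℂ) :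
    (Matrix (Fin n) (Fin n) ℂ)ˣ where
  val := Matrix.transvection a b c
  inv := Matrix.transvection a b (-c)
  val_inv := by rw [Matrix.transvection_mul_transvection_same _ _ hab]; simp
  inv_val := by rw [Matrix.transvection_mul_transvection_same _ _ hab]; simp

/-- The monoid generated by the transvections. -/
def transvectionMonoid (n : ℕ) : Submonoid (Matrix (Fin n) (Fin n) ℂ)ˣ :=
  Submonoid.closure {u | ∃ (a b : Fin n) (hab : a ≠ b) (c : ℂ), u = transvectionUnit hab c}

/-- Conjugating $1+cE_{ab}$ by an invertible diagonal matrix only rescales $c$ by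
$\delta_a/\delta_b$. -/
theorem exists_transvectionMonoid_mul_diagonal_swap {n : ℕ} (d : (Matrix (Fin n) (Fin n) ℂ)ˣ)
    {δ : Fin n → ℂ} (hd : (d : Matrix (Fin n) (Fin n) ℂ) = Matrix.diagonal δ)
    {s : (Matrix (Fin n) (Fin n) ℂ)ˣ} (hs : s ∈ transvectionMonoid n) :
    ∃ s' ∈ transvectionMonoid n, d * s = s' * d := by
  have hδ : ∀ a, δ a ≠ 0 := by
    have h : IsUnit (Matrix.diagonal δ) := hd ▸ d.isUnit
    rw [Matrix.isUnit_diagonal, Pi.isUnit_iff] at h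
    exact fun a => (h a).ne_zero
  induction hs using Submonoid.closure_induction with
  | mem x hx =>
    obtain ⟨a, b, hab, c, rfl⟩ := hx
    refine ⟨transvectionUnit hab (δ a * c / δ b),
      Submonoid.subset_closure ⟨a, b, hab, _, rfl⟩, ?_⟩
    ext1
    simp only [Units.val_mul, hd, transvectionUnit, Matrix.transvection, mul_add, add_mul, mul_one,
      one_mul]
    congr 1
    ext x y
    simp only [Matrix.diagonal_mul, Matrix.mul_diagonal, Matrix.single_apply]
    split_ifs with h
    · obtain ⟨rfl, rfl⟩ := h
      field_simp [hδ b]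
    · simp
  | one => exact ⟨1, one_mem _, by simp⟩
  | mul x y _ _ hx hy =>
    obtain ⟨s, hs, h1⟩ := hx
    obtain ⟨t, ht, h2⟩ := hy
    exact ⟨s * t, mul_mem hs ht, by rw [← mul_assoc, h1, mul_assoc, h2, mul_assoc]⟩

/-- Gaussian elimination, with all diagonal factors moved to the right, where they commute with the
diagonal matrices to be conjugated. -/
theorem exists_eq_transvectionMonoid_mul_diagonal {n : ℕ} (M : (Matrix (Fin n) (Fin n) ℂ)ˣ) :
    ∃ s ∈ transvectionMonoid n, ∃ (d : (Matrix (Fin n) (Fin n) ℂ)ˣ) (δ : Fin n → ℂ),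
      (d : Matrix (Fin n) (Fin n) ℂ) = Matrix.diagonal δ ∧ M = s * d := by
  suffices H : ∀ N : Matrix (Fin n) (Fin n) ℂ, N.det ≠ 0 →
      ∃ s ∈ transvectionMonoid n, ∃ (d : (Matrix (Fin n) (Fin n) ℂ)ˣ) (δ : Fin n → ℂ),
      (d : Matrix (Fin n) (Fin n) ℂ) = Matrix.diagonal δ ∧ N = (s * d : (Matrix _ _ ℂ)ˣ) by
    obtain ⟨s, hs, d, δ, hd, h⟩ := H M ((Matrix.isUnit_iff_isUnit_det _).1 M.isUnit).ne_zero
    exact ⟨s, hs, d, δ, hd, Units.ext h⟩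
  intro N hN
  refine Matrix.diagonal_transvection_induction_of_det_ne_zero
    (fun N => ∃ s ∈ transvectionMonoid n, ∃ (d : (Matrix (Fin n) (Fin n) ℂ)ˣ) (δ : Fin n → ℂ),
      (d : Matrix (Fin n) (Fin n) ℂ) = Matrix.diagonal δ ∧ N = (s * d : (Matrix _ _ ℂ)ˣ)) N hN ?_ ?_ ?_
  · intro D hD
    obtain ⟨u, hu⟩ := (Matrix.isUnit_iff_isUnit_det (Matrix.diagonal D)).2 (isUnit_iff_ne_zero.2 hD)
    exact ⟨1, one_mem _, u, D, hu, by simp [hu]⟩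
  · intro t
    exact ⟨transvectionUnit t.hij t.c, Submonoid.subset_closure ⟨_, _, _, _, rfl⟩, 1, 1,
      by simp, by simp [transvectionUnit, Matrix.TransvectionStruct.toMatrix]⟩
  · intro A B hA hB iA iB
    obtain ⟨s, hs, d, δ, hd, h1⟩ := iA
    obtain ⟨s', hs', d', δ', hd', h2⟩ := iB
    obtain ⟨t, ht, h⟩ := exists_transvectionMonoid_mul_diagonal_swap d hd hs'
    refine ⟨s * t, mul_mem hs ht, d * d', δ * δ', ?_, ?_⟩
    · rw [Units.val_mul, hd, hd', Matrix.diagonal_mul_diagonal]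
      rfl
    · rw [h1, h2, ← Units.val_mul]
      congr 1
      rw [mul_assoc, ← mul_assoc d, h]
      simp only [mul_assoc]

/-- A factor of a conjugation invariant polynomial is invariant under transvections, where
the product does not vanish. -/
theorem EntryPoly.evalAt_conj_transvection {n l : ℕ} {P Q : EntryPoly n l}
    (hD : EntryPoly.IsConjInvariant (P * Q)) {A : Fin l → Matrix (Fin n) (Fin n) ℂ}
    (hA : EntryPoly.evalAt (P * Q) A ≠ 0) (i : Fin l) {a b : Fin n} (hab : a ≠ b) (c : ℂ) :
    P.evalAt (conjTuple (Pi.mulSingle i (transvectionUnit hab c)) A) = P.evalAt A := by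
  -- The parameter $c$ is replaced by an indeterminate, so that `f P` and `f Q` are univariate
  -- polynomials in it.
  let B : Fin l → Matrix (Fin n) (Fin n) (Polynomial ℂ) := fun i' => if i' = i then
    Matrix.transvection a b Polynomial.X * (A i).map Polynomial.C *
      Matrix.transvection a b (-Polynomial.X) else (A i').map Polynomial.C
  let f : EntryPoly n l →ₐ[ℂ] Polynomial ℂ := aeval fun v => B v.1 v.2.1 v.2.2
  have hB : ∀ t i', (B i').map (Polynomial.eval t) =
      conjTuple (Pi.mulSingle i (transvectionUnit hab t)) A i' := by
    intro t i'
    by_cases hi : i' = i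
    · subst hi
      have hT : ∀ x : Polynomial ℂ,
          (Matrix.transvection a b x).map (Polynomial.evalRingHom t) =
            Matrix.transvection a b (x.eval t) := by
        intro x
        ext p q
        simp only [Matrix.transvection, Matrix.map_apply, Matrix.add_apply, map_add,
          Matrix.one_apply, Matrix.single_apply]
        split_ifs <;> simp
      have hC : ((A i').map Polynomial.C).map (Polynomial.evalRingHom t) = A i' := by
        ext; simp
      change (B i').map (Polynomial.evalRingHom t) = _
      simp only [B, if_true, Matrix.map_mul, hT, hC, conjTuple, Pi.mulSingle_eq_same]
      simp [transvectionUnit]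
    · ext p q
      simp [B, hi, conjTuple]
  have hf : ∀ (R : EntryPoly n l) t, (f R).eval t =
      R.evalAt (conjTuple (Pi.mulSingle i (transvectionUnit hab t)) A) := by
    intro R t
    rw [EntryPoly.evalAt, ← Polynomial.coe_evalRingHom, eval, aeval_def,
      eval₂_comp_left (Polynomial.evalRingHom t), coe_eval₂Hom]
    congr 1
    · ext; simp
    · funext v
      exact congrFun (congrFun (hB t v.1) v.2.1) v.2.2
  have hPQ : f P * f Q = Polynomial.C (EntryPoly.evalAt (P * Q) A) := by
    refine Polynomial.funext fun t => ?_
    rw [← map_mul, hf, hD.evalAt_conjTuple, Polynomial.eval_C]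
  -- A divisor of a nonzero constant in $\mathbb{C}[t]$ is constant; its value at $t=0$ is the value
  -- at $A$.
  have hu : IsUnit (f P) := isUnit_of_dvd_unit (Dvd.intro _ hPQ)
    (Polynomial.isUnit_C.2 (isUnit_iff_ne_zero.2 hA))
  obtain ⟨r, -, hr⟩ := Polynomial.isUnit_iff.1 hu
  have h0 := hf P 0
  have hT0 : transvectionUnit hab 0 = 1 := by ext1; simp [transvectionUnit]
  rw [hT0, Pi.mulSingle_one, conjTuple_one] at h0
  rw [← hf, ← h0, ← hr]
  simp

/-- The conjugations that preserve $P$ wherever $PQ\ne0$ form a monoid containing all transvections.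
The remaining diagonal factor of `M` fixes the diagonal tuple. -/
theorem EntryPoly.evalAt_conj_diagonal {n l : ℕ} {P Q : EntryPoly n l}
    (hD : EntryPoly.IsConjInvariant (P * Q)) {μ : Fin l → Fin n → ℂ}
    (hμ : EntryPoly.evalAt (P * Q) (fun i => Matrix.diagonal (μ i)) ≠ 0)
    (M : Fin l → (Matrix (Fin n) (Fin n) ℂ)ˣ) :
    P.evalAt (conjTuple M fun i => Matrix.diagonal (μ i)) =
      P.evalAt fun i => Matrix.diagonal (μ i) := by
  let K : Submonoid (Fin l → (Matrix (Fin n) (Fin n) ℂ)ˣ) :=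
    { carrier := {g | ∀ A, EntryPoly.evalAt (P * Q) A ≠ 0 →
        P.evalAt (conjTuple g A) = P.evalAt A}
      one_mem' := fun A _ => by rw [conjTuple_one]
      mul_mem' := fun {g h} hg hh A hA => by
        rw [conjTuple_mul, hg _ (by rwa [hD.evalAt_conjTuple]), hh _ hA] }
  choose s hs d δ hd hM using fun i => exists_eq_transvectionMonoid_mul_diagonal (M i)
  have hsK : s ∈ K := by
    refine Submonoid.pi_mem_of_mulSingle_mem s fun i => ?_
    have : transvectionMonoid n ≤ K.comap (MonoidHom.mulSingle _ i) := by
      rw [transvectionMonoid, Submonoid.closure_le]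
      rintro _ ⟨a, b, hab, c, rfl⟩
      exact fun A hA => EntryPoly.evalAt_conj_transvection hD hA i hab c
    exact this (hs i)
  have hMs : M = s * d := _root_.funext hM
  have hdiag : conjTuple d (fun i => Matrix.diagonal (μ i)) = fun i => Matrix.diagonal (μ i) := by
    ext1 i
    have : (d i : Matrix (Fin n) (Fin n) ℂ) * Matrix.diagonal (μ i) =
        Matrix.diagonal (μ i) * d i := by
      rw [hd, Matrix.diagonal_mul_diagonal, Matrix.diagonal_mul_diagonal]
      simp_rw [mul_comm]
    rw [conjTuple, this, mul_assoc, Units.mul_inv, mul_one]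
  rw [hMs, conjTuple_mul, hdiag]
  exact hsK _ hμ

/-! ### Eigenvalue lists and restriction to diagonal matrices -/

theorem exists_charpoly_eq_prod {n : ℕ} (A : Matrix (Fin n) (Fin n) ℂ) :
    ∃ μ : Fin n → ℂ, A.charpoly = ∏ j, (Polynomial.X - Polynomial.C (μ j)) := by
  obtain ⟨L, hL⟩ : ∃ L : List ℂ, (L : Multiset ℂ) = A.charpoly.roots := Quot.exists_rep _
  have hs := (IsAlgClosed.splits A.charpoly).eq_prod_roots_of_monic A.charpoly_monic
  have hlen : L.length = n := by
    have := (IsAlgClosed.splits A.charpoly).natDegree_eq_card_roots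
    rw [Matrix.charpoly_natDegree_eq_dim, Fintype.card_fin, ← hL] at this
    exact this.symm
  subst hlen
  refine ⟨L.get, ?_⟩
  rw [hs, ← hL]
  rw [Multiset.map_coe, Multiset.prod_coe, ← List.prod_ofFn]
  congr 1
  conv_lhs => rw [← List.ofFn_get L, List.map_ofFn]
  rfl

theorem exists_isEigenvalueList {n l : ℕ} (A : Fin l → Matrix (Fin n) (Fin n) ℂ) :
    ∃ μ : Fin l → Fin n → ℂ, IsEigenvalueList A μ := by
  choose μ hμ using fun i => exists_charpoly_eq_prod (A i)
  exact ⟨μ, hμ⟩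

theorem isEigenvalueList_diagonal {n l : ℕ} (μ : Fin l → Fin n → ℂ) :
    IsEigenvalueList (fun i => Matrix.diagonal (μ i)) μ :=
  fun i => Matrix.charpoly_diagonal (μ i)

theorem IsEigenvalueList.conjTuple {n l : ℕ} {A : Fin l → Matrix (Fin n) (Fin n) ℂ}
    {μ : Fin l → Fin n → ℂ} (h : IsEigenvalueList A μ)
    (g : Fin l → (Matrix (Fin n) (Fin n) ℂ)ˣ) : IsEigenvalueList (conjTuple g A) μ := by
  intro i
  rw [← h i]
  rw [_root_.conjTuple, Matrix.coe_units_inv]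
  exact Matrix.charpoly_units_conj (g i) (A i)

theorem exists_conj_diagonal {n : ℕ} {A : Matrix (Fin n) (Fin n) ℂ} {μ : Fin n → ℂ}
    (h : A.charpoly = ∏ j, (Polynomial.X - Polynomial.C (μ j))) (hμ : Function.Injective μ) :
    ∃ M : (Matrix (Fin n) (Fin n) ℂ)ˣ,
      A = M * Matrix.diagonal μ * (M⁻¹ : (Matrix (Fin n) (Fin n) ℂ)ˣ) := by
  have hev : ∀ j, ∃ v, Module.End.HasEigenvector (Matrix.toLin' A) (μ j) v := by
    intro j
    refine Module.End.HasEigenvalue.exists_hasEigenvector ?_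
    rw [Module.End.hasEigenvalue_iff_mem_spectrum, Matrix.spectrum_toLin']
    refine Matrix.mem_spectrum_of_isRoot_charpoly ?_
    rw [Polynomial.IsRoot, h, Polynomial.eval_prod]
    exact Finset.prod_eq_zero (Finset.mem_univ j) (by simp)
  choose v hv using hev
  have hli := Module.End.eigenvectors_linearIndependent' _ μ hμ v hv
  obtain ⟨M, hM⟩ := Matrix.linearIndependent_cols_iff_isUnit (A := (Matrix.of v).transpose).1 hli
  refine ⟨M, ?_⟩
  rw [Units.eq_mul_inv_iff_mul_eq, hM]
  ext a b
  have := congrFun (hv b).apply_eq_smul a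
  rw [Matrix.toLin'_apply] at this
  rw [Matrix.mul_diagonal]
  simpa [Matrix.mul_apply, Matrix.mulVec, dotProduct, mul_comm] using this

/-- The product of the differences of eigenvalues of the same matrix. -/
noncomputable def EigPoly.discr (n l : ℕ) : EigPoly n l :=
  ∏ i, ∏ a, ∏ b, if a = b then 1 else X (i, a) - X (i, b)

theorem EigPoly.discr_ne_zero (n l : ℕ) : EigPoly.discr n l ≠ 0 := by
  refine Finset.prod_ne_zero_iff.2 fun i _ => Finset.prod_ne_zero_iff.2 fun a _ =>
    Finset.prod_ne_zero_iff.2 fun b _ => ?_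
  split_ifs with h
  · exact one_ne_zero
  · rw [sub_ne_zero]
    exact fun e => h (by simpa using X_injective e)

/-- The product runs over ordered pairs $(a,b)$, so reindexing produces no sign. -/
theorem EigPoly.isBlockSymm_discr (n l : ℕ) : (EigPoly.discr n l).IsBlockSymm := by
  intro w
  simp only [discr, perm, map_prod]
  refine Finset.prod_congr rfl fun i _ => Fintype.prod_equiv (w i) _ _ fun a =>
    Fintype.prod_equiv (w i) _ _ fun b => ?_
  simp only [EmbeddingLike.apply_eq_iff_eq]
  split_ifs <;> simp

theorem EigPoly.injective_of_eval_discr_ne_zero {n l : ℕ} {μ : Fin l → Fin n → ℂ}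
    (h : eval (fun v => μ v.1 v.2) (EigPoly.discr n l) ≠ 0) (i : Fin l) :
    Function.Injective (μ i) := by
  intro a b hab
  by_contra hne
  simp only [discr, map_prod, Finset.prod_ne_zero_iff] at h
  exact h i (Finset.mem_univ _) a (Finset.mem_univ _) b (Finset.mem_univ _) (by simp [hne, hab])

/-- The restriction of a polynomial in the matrix entries to tuples of diagonal matrices. -/
noncomputable def EntryPoly.diag (n l : ℕ) : EntryPoly n l →ₐ[ℂ] EigPoly n l :=
  aeval fun v => if v.2.1 = v.2.2 then X (v.1, v.2.1) else 0

theorem EntryPoly.eval_diag {n l : ℕ} (P : EntryPoly n l) (μ : Fin l → Fin n → ℂ) :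
    eval (fun v => μ v.1 v.2) (EntryPoly.diag n l P) =
      P.evalAt fun i => Matrix.diagonal (μ i) := by
  rw [diag, eval_aeval_eq, evalAt]
  congr 2
  funext v
  simp only [Matrix.diagonal_apply]
  split_ifs <;> simp

/-- `d` is the value of the polynomial `p` at the eigenvalues. -/
def EntryPoly.IsLift {n l : ℕ} (d : EntryPoly n l) (p : EigPoly n l) : Prop :=
  ∀ (A : Fin l → Matrix (Fin n) (Fin n) ℂ) (μ : Fin l → Fin n → ℂ),
    IsEigenvalueList A μ → d.evalAt A = eval (fun v => μ v.1 v.2) p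

theorem EigPoly.funext {n l : ℕ} {p q : EigPoly n l}
    (h : ∀ μ : Fin l → Fin n → ℂ, eval (fun v => μ v.1 v.2) p = eval (fun v => μ v.1 v.2) q) :
    p = q :=
  MvPolynomial.funext fun x => h fun i j => x (i, j)

theorem EntryPoly.IsLift.diag_eq {n l : ℕ} {d : EntryPoly n l} {p : EigPoly n l}
    (h : d.IsLift p) : EntryPoly.diag n l d = p :=
  EigPoly.funext fun μ => by rw [eval_diag, h _ μ (isEigenvalueList_diagonal μ)]

theorem EntryPoly.IsLift.unique {n l : ℕ} {d d' : EntryPoly n l} {p : EigPoly n l}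
    (h : d.IsLift p) (h' : d'.IsLift p) : d = d' :=
  EntryPoly.funext fun A => by
    obtain ⟨μ, hμ⟩ := exists_isEigenvalueList A
    rw [h A μ hμ, h' A μ hμ]

theorem EntryPoly.IsLift.isConjInvariant {n l : ℕ} {d : EntryPoly n l} {p : EigPoly n l}
    (h : d.IsLift p) : d.IsConjInvariant := by
  intro A g
  obtain ⟨μ, hμ⟩ := exists_isEigenvalueList A
  rw [h A μ hμ, ← h _ μ (hμ.conjTuple g)]
  rfl

/-- A factor of a conjugation invariant polynomial that is constant on diagonal matrices is
constant. -/
theorem EntryPoly.eq_C_of_diag_eq_C {n l : ℕ} {P Q : EntryPoly n l}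
    (hD : EntryPoly.IsConjInvariant (P * Q)) (h0 : P * Q ≠ 0) {c : ℂ}
    (hP : EntryPoly.diag n l P = C c) : P = C c := by
  obtain ⟨δ, hδ⟩ := (EigPoly.isBlockSymm_discr n l).exists_entryPoly
  have hδ : δ.IsLift _ := hδ
  have hδ0 : δ ≠ 0 := by
    rintro rfl
    exact EigPoly.discr_ne_zero n l (by rw [← hδ.diag_eq, map_zero])
  -- The factor $\delta$ vanishes at repeated eigenvalues. Off the zeros of $PQ\delta$ every $A_i$
  -- is diagonalizable, so $P=c$ there; elsewhere the product vanishes anyway.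
  suffices H : (P - C c) * (P * Q * δ) = 0 by
    rcases mul_eq_zero.1 H with h | h
    · exact sub_eq_zero.1 h
    · exact absurd h (mul_ne_zero h0 hδ0)
  refine EntryPoly.funext fun A => ?_
  rw [evalAt_mul, evalAt_mul (P * Q)]
  have hz : EntryPoly.evalAt (0 : EntryPoly n l) A = 0 := map_zero _
  rw [hz, mul_eq_zero, mul_eq_zero]
  by_cases h1 : EntryPoly.evalAt (P * Q) A = 0
  · exact Or.inr (Or.inl h1)
  by_cases h2 : δ.evalAt A = 0
  · exact Or.inr (Or.inr h2)
  left
  obtain ⟨μ, hμ⟩ := exists_isEigenvalueList A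
  rw [hδ A μ hμ] at h2
  choose M hM using fun i =>
    exists_conj_diagonal (hμ i) (EigPoly.injective_of_eval_discr_ne_zero h2 i)
  have hA : A = conjTuple M fun i => Matrix.diagonal (μ i) := _root_.funext hM
  have hPA : P.evalAt A = c := by
    rw [hA, evalAt_conj_diagonal hD, ← eval_diag, hP, eval_C]
    rwa [hA, hD.evalAt_conjTuple] at h1
  simp only [evalAt] at hPA ⊢
  rw [map_sub, hPA, eval_C, sub_self]

/-- The restriction to the diagonal of a factor of a conjugation invariant polynomial is block
symmetric. -/
theorem EntryPoly.isBlockSymm_diag {n l : ℕ} {P Q : EntryPoly n l}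
    (hD : EntryPoly.IsConjInvariant (P * Q)) (h0 : EntryPoly.diag n l (P * Q) ≠ 0) :
    (EntryPoly.diag n l P).IsBlockSymm := by
  intro w
  suffices H : (EigPoly.perm w (EntryPoly.diag n l P) - EntryPoly.diag n l P) *
      EntryPoly.diag n l (P * Q) = 0 from sub_eq_zero.1 ((mul_eq_zero.1 H).resolve_right h0)
  refine EigPoly.funext fun μ => ?_
  rw [map_mul, map_zero, mul_eq_zero, or_iff_not_imp_right, eval_diag]
  intro h
  rw [map_sub, sub_eq_zero, EigPoly.eval_perm, eval_diag,
    eval_diag P (fun i j => μ i (w i j))]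
  -- Permuting diagonal entries is conjugation by permutation matrices.
  have hw : ∀ i, (w i).permMatrix ℂ * ((w i)⁻¹).permMatrix ℂ = 1 := fun i => by
    rw [← Matrix.permMatrix_mul]; simp
  have hw' : ∀ i, ((w i)⁻¹).permMatrix ℂ * (w i).permMatrix ℂ = 1 := fun i => by
    rw [← Matrix.permMatrix_mul]; simp
  rw [← evalAt_conj_diagonal hD h fun i => ⟨_, _, hw i, hw' i⟩]
  congr 1
  ext i a b
  simp only [conjTuple, Units.inv_mk]
  rw [Equiv.Perm.permMatrix, Equiv.Perm.permMatrix, PEquiv.toMatrix_toPEquiv_mul,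
    PEquiv.mul_toMatrix_toPEquiv]
  simp [Matrix.diagonal_apply, Equiv.Perm.inv_def]

/-- A polynomial in the eigenvalues with no nontrivial block symmetric factorization lifts to an
irreducible polynomial in the entries. -/
theorem EntryPoly.IsLift.irreducible {n l : ℕ} {d : EntryPoly n l} {p : EigPoly n l}
    (h : d.IsLift p) (h0 : p ≠ 0) (hu : ¬ IsUnit p)
    (hp : ∀ a b : EigPoly n l, a.IsBlockSymm → b.IsBlockSymm → p = a * b → IsUnit a ∨ IsUnit b) :
    Irreducible d := by
  have key : ∀ P Q : EntryPoly n l, d = P * Q → IsUnit (EntryPoly.diag n l P) → IsUnit P := by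
    intro P Q hd hP
    obtain ⟨r, hr, e⟩ := MvPolynomial.isUnit_iff_eq_C_of_isReduced.1 hP
    have hd0 : d ≠ 0 := by
      rintro rfl
      exact h0 (by rw [← h.diag_eq, map_zero])
    rw [eq_C_of_diag_eq_C (hd ▸ h.isConjInvariant) (hd ▸ hd0) e]
    exact hr.map C
  refine ⟨fun H => hu (h.diag_eq ▸ H.map (EntryPoly.diag n l)), fun P Q hd => ?_⟩
  have hinv := h.isConjInvariant
  have hne : EntryPoly.diag n l d ≠ 0 := by rwa [h.diag_eq]
  have hd' : d = Q * P := by rw [hd, mul_comm]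
  rcases hp (EntryPoly.diag n l P) (EntryPoly.diag n l Q)
    (isBlockSymm_diag (hd ▸ hinv) (hd ▸ hne)) (isBlockSymm_diag (hd' ▸ hinv) (hd' ▸ hne))
    (by rw [← map_mul, ← hd, h.diag_eq]) with H | H
  · exact Or.inl (key P Q hd H)
  · exact Or.inr (key Q P hd' H)

/-! ### The linear forms of disjoint pairs -/

/-- Pairs `(F, G)` of functions from `[l]` to the subsets of `[n]`. -/
abbrev SubsetPair (n l : ℕ) : Type := (Fin l → Finset (Fin n)) × (Fin l → Finset (Fin n))

theorem mem_disjointSubsetPairs {n l : ℕ} {k' : Fin l → ℕ} {p : SubsetPair n l} :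
    p ∈ disjointSubsetPairs k' ↔
      ∀ i, (p.1 i).card = k' i ∧ (p.2 i).card = k' i ∧ Disjoint (p.1 i) (p.2 i) := by
  simp [disjointSubsetPairs]

namespace SubsetPair

variable {n l : ℕ}

/-- The coefficients of the linear form of a pair `(F, G)`. -/
noncomputable def coeff (p : SubsetPair n l) (v : Fin l × Fin n) : ℂ :=
  (if v.2 ∈ p.1 v.1 then 1 else 0) - (if v.2 ∈ p.2 v.1 then 1 else 0)

/-- The linear form `∑_i (∑_{j ∈ F(i)} X_{i,j} - ∑_{j ∈ G(i)} X_{i,j})`. -/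
noncomputable def form (p : SubsetPair n l) : EigPoly n l :=
  sumSMulX (Finsupp.equivFunOnFinite.symm p.coeff)

theorem form_eq_sum (p : SubsetPair n l) : p.form = ∑ v, C (p.coeff v) * X v := by
  rw [form, sumSMulX, Finsupp.linearCombination_apply, Finsupp.sum_fintype _ _ (by simp)]
  simp [smul_eq_C_mul]

theorem coeff_form (p : SubsetPair n l) (v : Fin l × Fin n) :
    MvPolynomial.coeff (Finsupp.single v 1) p.form = p.coeff v := by
  rw [form, coeff_sumSMulX]; rfl

theorem eval_form (p : SubsetPair n l) (μ : Fin l → Fin n → ℂ) :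
    eval (fun v => μ v.1 v.2) p.form =
      ∑ i, (∑ j ∈ p.1 i, μ i j - ∑ j ∈ p.2 i, μ i j) := by
  rw [form_eq_sum, map_sum, Fintype.sum_prod_type]
  refine Finset.sum_congr rfl fun i _ => ?_
  simp only [map_mul, eval_C, eval_X, coeff, sub_mul, ite_mul, one_mul, zero_mul,
    Finset.sum_sub_distrib, Finset.sum_ite_mem, Finset.univ_inter]

theorem coeff_swap (p : SubsetPair n l) (v : Fin l × Fin n) :
    coeff p.swap v = -p.coeff v := by
  simp [coeff]

theorem form_swap (p : SubsetPair n l) : form p.swap = -p.form := by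
  simp [form_eq_sum, coeff_swap]

variable {k' k'' : Fin l → ℕ}

theorem swap_mem {p : SubsetPair n l} (hp : p ∈ disjointSubsetPairs k') :
    p.swap ∈ disjointSubsetPairs k' := by
  rw [mem_disjointSubsetPairs] at hp ⊢
  exact fun i => ⟨(hp i).2.1, (hp i).1, (hp i).2.2.symm⟩

theorem mem_fst_iff {p : SubsetPair n l} (hp : p ∈ disjointSubsetPairs k') (i : Fin l)
    (j : Fin n) : j ∈ p.1 i ↔ p.coeff (i, j) = 1 := by
  have h : j ∈ p.1 i → j ∉ p.2 i := fun h =>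
    Finset.disjoint_left.1 (mem_disjointSubsetPairs.1 hp i).2.2 h
  by_cases h1 : j ∈ p.1 i
  · simp [coeff, h1, h h1]
  · simp only [coeff, h1, if_false, false_iff]
    split_ifs <;> norm_num

theorem mem_snd_iff {p : SubsetPair n l} (hp : p ∈ disjointSubsetPairs k') (i : Fin l)
    (j : Fin n) : j ∈ p.2 i ↔ p.coeff (i, j) = -1 := by
  rw [← neg_eq_iff_eq_neg, ← coeff_swap, ← mem_fst_iff (swap_mem hp)]
  rfl

theorem coeff_cases (p : SubsetPair n l) (v : Fin l × Fin n) :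
    p.coeff v = 0 ∨ p.coeff v = 1 ∨ p.coeff v = -1 := by
  simp only [coeff]
  split_ifs <;> norm_num

theorem eq_of_coeff_eq {p q : SubsetPair n l} (hp : p ∈ disjointSubsetPairs k')
    (hq : q ∈ disjointSubsetPairs k'') (h : ∀ v, p.coeff v = q.coeff v) : p = q := by
  refine Prod.ext ?_ ?_ <;> ext i j
  · rw [mem_fst_iff hp, mem_fst_iff hq, h]
  · rw [mem_snd_iff hp, mem_snd_iff hq, h]

theorem exists_coeff_ne_zero {p : SubsetPair n l} (hp : p ∈ disjointSubsetPairs k')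
    (hk : ∃ i, k' i ≠ 0) : ∃ v, p.coeff v ≠ 0 := by
  obtain ⟨i, hi⟩ := hk
  rw [← (mem_disjointSubsetPairs.1 hp i).1, Finset.card_ne_zero] at hi
  obtain ⟨j, hj⟩ := hi
  exact ⟨(i, j), by rw [(mem_fst_iff hp i j).1 hj]; exact one_ne_zero⟩

/-- A linear form with a nonzero coefficient over a field is irreducible, hence prime by unique
factorization. -/
theorem prime_form {p : SubsetPair n l} (hp : p ∈ disjointSubsetPairs k')
    (hk : ∃ i, k' i ≠ 0) : Prime p.form := by
  obtain ⟨v, hv⟩ := exists_coeff_ne_zero hp hk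
  refine (irreducible_sumSMulX _ ⟨v, by simpa using hv⟩ fun r hr => ?_).prime
  exact isUnit_of_dvd_unit (hr v) (isUnit_iff_ne_zero.2 (by simpa using hv))

/-- The forms differ by a scalar, and since all coefficients are $0$ or $\pm1$ that scalar is
$\pm1$. By disjointness the coefficients determine the pair. -/
theorem eq_or_eq_swap_of_associated {p q : SubsetPair n l} (hp : p ∈ disjointSubsetPairs k')
    (hq : q ∈ disjointSubsetPairs k'') (hk : ∃ i, k' i ≠ 0) (h : Associated p.form q.form) :
    p = q ∨ p = q.swap := by
  obtain ⟨u, hu⟩ := h.symm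
  obtain ⟨r, -, hr⟩ := MvPolynomial.isUnit_iff_eq_C_of_isReduced.1 u.isUnit
  have hc : ∀ v, p.coeff v = r * q.coeff v := fun v => by
    rw [← coeff_form, ← hu, hr, mul_comm, coeff_C_mul, coeff_form]
  obtain ⟨v, hv⟩ := exists_coeff_ne_zero hp hk
  have hr : r = 1 ∨ r = -1 := by
    have h1 := hc v
    rcases coeff_cases p v with h | h | h <;> rcases coeff_cases q v with h' | h' | h' <;> grind
  rcases hr with rfl | rfl
  · exact Or.inl (eq_of_coeff_eq hp hq fun v => by rw [hc, one_mul])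
  · exact Or.inr (eq_of_coeff_eq hp (swap_mem hq) fun v => by rw [hc, coeff_swap, neg_one_mul])

theorem eq_of_form_dvd_form {p q : SubsetPair n l} (hp : p ∈ disjointSubsetPairs k')
    (hq : q ∈ disjointSubsetPairs k'') (hk : ∃ i, k' i ≠ 0) (hk' : ∃ i, k'' i ≠ 0)
    (h : p.form ∣ q.form) : k' = k'' := by
  have hq' : q.swap ∈ disjointSubsetPairs k'' := swap_mem hq
  funext i
  rw [← (mem_disjointSubsetPairs.1 hp i).1]
  rcases eq_or_eq_swap_of_associated hp hq hk
    ((prime_form hp hk).associated_of_dvd (prime_form hq hk') h) with e | e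
  · rw [e, (mem_disjointSubsetPairs.1 hq i).1]
  · rw [e, (mem_disjointSubsetPairs.1 hq' i).1]

theorem ne_swap {p : SubsetPair n l} (hp : p ∈ disjointSubsetPairs k')
    (hk : ∃ i, k' i ≠ 0) : p.1 ≠ p.2 := by
  obtain ⟨v, hv⟩ := exists_coeff_ne_zero hp hk
  intro h
  exact hv (by simp [coeff, h])

theorem perm_form_eq {p q : SubsetPair n l} {w : Fin l → Equiv.Perm (Fin n)}
    (h : ∀ i j, q.coeff (i, w i j) = p.coeff (i, j)) :
    EigPoly.perm w p.form = q.form := by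
  rw [form_eq_sum, form_eq_sum, map_sum, Fintype.sum_prod_type, Fintype.sum_prod_type]
  refine Finset.sum_congr rfl fun i _ => Fintype.sum_equiv (w i) _ _ fun j => ?_
  simp [EigPoly.perm, h]

/-- The action of a tuple of permutations on pairs. -/
def permute (w : Fin l → Equiv.Perm (Fin n)) (p : SubsetPair n l) : SubsetPair n l :=
  (fun i => (p.1 i).map (w i).toEmbedding, fun i => (p.2 i).map (w i).toEmbedding)

theorem permute_mem (w : Fin l → Equiv.Perm (Fin n)) {p : SubsetPair n l}
    (hp : p ∈ disjointSubsetPairs k') : permute w p ∈ disjointSubsetPairs k' := by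
  rw [mem_disjointSubsetPairs] at hp ⊢
  intro i
  simpa [permute] using hp i

theorem perm_form (w : Fin l → Equiv.Perm (Fin n)) (p : SubsetPair n l) :
    EigPoly.perm w p.form = (permute w p).form :=
  perm_form_eq fun i j => by simp [coeff, permute]

/-- In block $i$ the coefficients $1,-1,0$ occur $k'_i,k'_i,n-2k'_i$ times for both pairs, so
bijections between the fibres glue to a permutation. -/
theorem exists_perm_form_eq {p q : SubsetPair n l} (hp : p ∈ disjointSubsetPairs k')
    (hq : q ∈ disjointSubsetPairs k') :
    ∃ w : Fin l → Equiv.Perm (Fin n), EigPoly.perm w p.form = q.form := by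
  have H : ∀ (p : SubsetPair n l), p ∈ disjointSubsetPairs k' → ∀ i (c : ℂ),
      (Finset.univ.filter fun j => p.coeff (i, j) = c).card =
        if c = 1 then k' i else if c = -1 then k' i else
          if c = 0 then n - (k' i + k' i) else 0 := by
    intro p hp i c
    obtain ⟨h1, h2, h3⟩ := mem_disjointSubsetPairs.1 hp i
    split_ifs with hc1 hc2 hc3
    · rw [← h1]; congr 1; ext j; simp [mem_fst_iff hp, hc1]
    · rw [← h2]; congr 1; ext j; simp [mem_snd_iff hp, hc2]
    · have hcard := Finset.card_compl (p.1 i ∪ p.2 i)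
      rw [Finset.card_union_of_disjoint h3, h1, h2, Fintype.card_fin] at hcard
      rw [← hcard]
      congr 1
      ext j
      simp only [Finset.mem_filter, Finset.mem_univ, true_and, Finset.mem_compl, Finset.mem_union,
        mem_fst_iff hp, mem_snd_iff hp, hc3]
      rcases coeff_cases p (i, j) with h | h | h <;> norm_num [h]
    · rw [Finset.card_eq_zero, Finset.filter_eq_empty_iff]
      rintro j - rfl
      rcases coeff_cases p (i, j) with h | h | h <;> simp_all
  have E : ∀ i, ∃ w : Equiv.Perm (Fin n), ∀ j, q.coeff (i, w j) = p.coeff (i, j) := by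
    intro i
    have e : ∀ c, Nonempty ({j // p.coeff (i, j) = c} ≃ {j // q.coeff (i, j) = c}) := by
      intro c
      refine Fintype.card_eq.1 ?_
      rw [Fintype.card_subtype, Fintype.card_subtype, H p hp, H q hq]
    exact ⟨Equiv.ofFiberEquiv fun c => (e c).some, fun j => Equiv.ofFiberEquiv_map
      (f := fun j => p.coeff (i, j)) (g := fun j => q.coeff (i, j)) (fun c => (e c).some) j⟩
  choose w hw using E
  exact ⟨w, perm_form_eq hw⟩

/-- The pair of singletons `{a}`, `{b}` at the index `i`. -/
def single (i : Fin l) (a b : Fin n) : SubsetPair n l :=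
  (fun i' => if i' = i then {a} else ∅, fun i' => if i' = i then {b} else ∅)

theorem single_mem (i : Fin l) {a b : Fin n} (hab : a ≠ b) :
    single i a b ∈ disjointSubsetPairs (Pi.single i 1 : Fin l → ℕ) := by
  rw [mem_disjointSubsetPairs]
  intro i'
  by_cases h : i' = i
  · subst h
    simp [single, hab]
  · simp [single, h]

theorem form_single (i : Fin l) (a b : Fin n) :
    (single i a b).form = X (i, a) - X (i, b) := by
  refine EigPoly.funext fun μ => ?_
  rw [eval_form, Finset.sum_eq_single i]
  · simp [single]
  · intro i' _ h
    simp [single, h]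
  · simp

end SubsetPair

/-! ### The product of the forms and its square root -/

namespace EigPoly

variable {n l : ℕ} {k' k'' : Fin l → ℕ}

theorem perm_X (w : Fin l → Equiv.Perm (Fin n)) (i : Fin l) (j : Fin n) :
    perm w (X (i, j)) = X (i, w i j) := by
  simp [perm]

theorem perm_one : perm (1 : Fin l → Equiv.Perm (Fin n)) = AlgHom.id ℂ _ := by
  ext v
  simp [perm]

theorem perm_mul (w w' : Fin l → Equiv.Perm (Fin n)) :
    perm (w * w') = (perm w).comp (perm w') := by
  ext v
  simp [perm]

/-- `X_{i,a} - X_{i,b}` divides `R - τ R` for the transposition `τ = (a b)` at `i`. -/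
theorem sub_dvd_sub_perm_swap (i : Fin l) (a b : Fin n) (R : EigPoly n l) :
    X (i, a) - X (i, b) ∣ R - perm (Pi.mulSingle i (Equiv.swap a b)) R := by
  induction R using MvPolynomial.induction_on with
  | C r => simp [perm]
  | add p q hp hq =>
    rw [map_add, add_sub_add_comm]
    exact dvd_add hp hq
  | mul_X p v hp =>
    obtain ⟨i', j⟩ := v
    rw [map_mul, perm_X]
    set τ : Fin l → Equiv.Perm (Fin n) := Pi.mulSingle i (Equiv.swap a b) with hτ
    have hX : (X (i, a) - X (i, b) : EigPoly n l) ∣ X (i', j) - X (i', τ i' j) := by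
      by_cases h : i' = i
      · subst h
        rw [hτ, Pi.mulSingle_eq_same, Equiv.swap_apply_def]
        split_ifs with h1 h2
        · rw [h1]
        · rw [h2, ← neg_sub, neg_dvd]
        · simp
      · simp [hτ, h]
    have : p * X (i', j) - perm τ p * X (i', τ i' j) =
        (p - perm τ p) * X (i', j) + perm τ p * (X (i', j) - X (i', τ i' j)) := by ring
    rw [this]
    exact dvd_add (hp.mul_right _) (hX.mul_left _)

theorem isBlockSymm_of_swap {p : EigPoly n l}
    (h : ∀ i a b, a ≠ b → perm (Pi.mulSingle i (Equiv.swap a b)) p = p) : p.IsBlockSymm := by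
  let K : Submonoid (Fin l → Equiv.Perm (Fin n)) :=
    { carrier := {w | perm w p = p}
      one_mem' := by simp [perm_one]
      mul_mem' := fun {w w'} hw hw' => by
        change perm (w * w') p = p
        rw [perm_mul, AlgHom.comp_apply, hw', hw] }
  intro w
  refine Submonoid.pi_mem_of_mulSingle_mem (H := K) w fun i => ?_
  induction w i using Equiv.Perm.swap_induction_on with
  | one => rw [Pi.mulSingle_one]; exact one_mem _
  | swap_mul f a b hab hf =>
    rw [Pi.mulSingle_mul]
    exact mul_mem (h i a b hab) hf

variable (k') in
/-- The product of the linear forms of all disjoint pairs. -/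
noncomputable def pairProd : EigPoly n l := ∏ p ∈ disjointSubsetPairs k', SubsetPair.form p

theorem eval_pairProd (μ : Fin l → Fin n → ℂ) :
    eval (fun v => μ v.1 v.2) (pairProd k') = eigenvalueProduct k' μ := by
  rw [pairProd, map_prod, eigenvalueProduct]
  exact Finset.prod_congr rfl fun p _ => SubsetPair.eval_form p μ

theorem isBlockSymm_pairProd : (pairProd k' : EigPoly n l).IsBlockSymm := by
  intro w
  rw [pairProd, map_prod]
  refine Finset.prod_nbij' (SubsetPair.permute w) (SubsetPair.permute w⁻¹)
    (fun p hp => SubsetPair.permute_mem w hp) (fun p hp => SubsetPair.permute_mem _ hp)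
    (fun p _ => ?_) (fun p _ => ?_) (fun p _ => SubsetPair.perm_form w p)
  · refine Prod.ext ?_ ?_ <;> ext i j <;> simp [SubsetPair.permute, Equiv.Perm.inv_def]
  · refine Prod.ext ?_ ?_ <;> ext i j <;> simp [SubsetPair.permute, Equiv.Perm.inv_def]

variable (k') in
/-- One pair out of each `{(F, G), (G, F)}`. -/
noncomputable def halfPairs : Finset (SubsetPair n l) :=
  (disjointSubsetPairs k').filter fun p =>
    Fintype.equivFin (Fin l → Finset (Fin n)) p.1 < Fintype.equivFin _ p.2

variable (k') in
/-- A square root of `pairProd k'`. -/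
noncomputable def halfProd : EigPoly n l :=
  C ((Complex.I) ^ (halfPairs (n := n) k').card) * ∏ p ∈ halfPairs k', SubsetPair.form p

theorem pairProd_eq_halfProd_sq (hk : ∃ i, k' i ≠ 0) :
    (pairProd k' : EigPoly n l) = halfProd k' ^ 2 := by
  have h1 : ∏ p ∈ (disjointSubsetPairs (n := n) k').filter (fun p =>
      ¬ Fintype.equivFin (Fin l → Finset (Fin n)) p.1 < Fintype.equivFin _ p.2),
      SubsetPair.form p = ∏ p ∈ halfPairs k', -SubsetPair.form p := by
    refine Finset.prod_nbij' Prod.swap Prod.swap ?_ ?_ (fun _ _ => rfl) (fun _ _ => rfl)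
      (fun p _ => by rw [SubsetPair.form_swap, neg_neg])
    · intro p hp
      rw [Finset.mem_filter] at hp
      refine Finset.mem_filter.2 ⟨SubsetPair.swap_mem hp.1, ?_⟩
      refine lt_of_le_of_ne (not_lt.1 hp.2) fun h => ?_
      exact SubsetPair.ne_swap hp.1 hk ((Fintype.equivFin _).injective h).symm
    · intro p hp
      rw [halfPairs, Finset.mem_filter] at hp
      exact Finset.mem_filter.2 ⟨SubsetPair.swap_mem hp.1, not_lt.2 hp.2.le⟩
  -- Swapping turns the other half into $(-1)^m$ times the chosen half, $m$ being the size of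
  -- `halfPairs`; the constant $i^m$ in `halfProd` absorbs this sign.
  rw [pairProd, ← Finset.prod_filter_mul_prod_filter_not (disjointSubsetPairs k') (fun p =>
    Fintype.equivFin (Fin l → Finset (Fin n)) p.1 < Fintype.equivFin _ p.2), h1,
    Finset.prod_neg, halfProd, mul_pow, ← map_pow, ← pow_mul, mul_comm _ 2, pow_mul,
    Complex.I_sq, map_pow, map_neg, map_one, ← halfPairs]
  ring

theorem form_dvd_halfProd (hk : ∃ i, k' i ≠ 0) {p : SubsetPair n l}
    (hp : p ∈ disjointSubsetPairs k') : p.form ∣ halfProd k' := by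
  refine (SubsetPair.prime_form hp hk).dvd_of_dvd_pow (n := 2) ?_
  rw [← pairProd_eq_halfProd_sq hk]
  exact Finset.dvd_prod_of_mem _ hp

theorem not_associated_of_mem_halfPairs (hk : ∃ i, k' i ≠ 0) {p q : SubsetPair n l}
    (hp : p ∈ halfPairs k') (hq : q ∈ halfPairs k') (hpq : p ≠ q) :
    ¬ Associated p.form q.form := by
  intro h
  rw [halfPairs, Finset.mem_filter] at hp hq
  rcases SubsetPair.eq_or_eq_swap_of_associated hp.1 hq.1 hk h with rfl | rfl
  · exact hpq rfl
  · exact lt_asymm hp.2 hq.2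

theorem halfProd_dvd (hk : ∃ i, k' i ≠ 0) {Q : EigPoly n l}
    (h : ∀ p ∈ disjointSubsetPairs k', SubsetPair.form p ∣ Q) : halfProd k' ∣ Q := by
  have hu : IsUnit (C (Complex.I ^ (halfPairs (n := n) k').card) : EigPoly n l) :=
    (isUnit_iff_ne_zero.2 (pow_ne_zero _ Complex.I_ne_zero)).map C
  rw [halfProd, hu.mul_left_dvd]
  refine Finset.prod_dvd_of_isRelPrime (fun p hp q hq hpq => ?_)
    fun p hp => h p (Finset.mem_filter.1 hp).1
  have hp' := SubsetPair.prime_form (Finset.mem_filter.1 hp).1 hk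
  have hq' := SubsetPair.prime_form (Finset.mem_filter.1 hq).1 hk
  exact hp'.irreducible.isRelPrime_iff_not_dvd.2 fun hd =>
    not_associated_of_mem_halfPairs hk hp hq hpq (hp'.associated_of_dvd hq' hd)

/-- Distinct chosen pairs have non-associated prime forms. For a pair that was not chosen, pass to
its swap: the sign cancels in the square. -/
theorem not_form_sq_dvd_halfProd (hk : ∃ i, k' i ≠ 0) {p : SubsetPair n l}
    (hp : p ∈ disjointSubsetPairs k') : ¬ p.form * p.form ∣ halfProd k' := by
  have key : ∀ p : SubsetPair n l, p ∈ halfPairs k' → ¬ p.form * p.form ∣ halfProd k' := by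
    classical
    intro p hp h
    have hp' := SubsetPair.prime_form (Finset.mem_filter.1 hp).1 hk
    have hu : IsUnit (C (Complex.I ^ (halfPairs (n := n) k').card) : EigPoly n l) :=
      (isUnit_iff_ne_zero.2 (pow_ne_zero _ Complex.I_ne_zero)).map C
    rw [halfProd, hu.dvd_mul_left, ← Finset.mul_prod_erase _ _ hp,
      mul_dvd_mul_iff_left hp'.ne_zero, hp'.dvd_finsetProd_iff] at h
    obtain ⟨q, hq, hd⟩ := h
    rw [Finset.mem_erase] at hq
    exact not_associated_of_mem_halfPairs hk hp hq.2 hq.1.symm (hp'.associated_of_dvd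
      (SubsetPair.prime_form (Finset.mem_filter.1 hq.2).1 hk) hd)
  rcases lt_or_gt_of_ne ((Fintype.equivFin _).injective.ne (SubsetPair.ne_swap hp hk)) with h | h
  · exact key p (Finset.mem_filter.2 ⟨hp, h⟩)
  · have := key p.swap (Finset.mem_filter.2 ⟨SubsetPair.swap_mem hp, h⟩)
    rwa [SubsetPair.form_swap, neg_mul_neg] at this

theorem perm_halfProd (hk : ∃ i, k' i ≠ 0) (w : Fin l → Equiv.Perm (Fin n)) :
    perm w (halfProd k') = halfProd k' ∨ perm w (halfProd k') = -halfProd k' := by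
  rw [← sq_eq_sq_iff_eq_or_eq_neg, ← map_pow, ← pairProd_eq_halfProd_sq hk]
  exact isBlockSymm_pairProd w

theorem halfProd_ne_zero (hk : ∃ i, k' i ≠ 0) : (halfProd k' : EigPoly n l) ≠ 0 :=
  mul_ne_zero (C_ne_zero.2 (pow_ne_zero _ Complex.I_ne_zero))
    (Finset.prod_ne_zero_iff.2 fun _ hp =>
      (SubsetPair.prime_form (Finset.mem_filter.1 hp).1 hk).ne_zero)

/-- A polynomial that is symmetric up to sign and divisible by the form of one pair is divisible by
`halfProd k'`. -/
theorem halfProd_dvd_of_form_dvd (hk : ∃ i, k' i ≠ 0) {Q : EigPoly n l}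
    (hQ : ∀ w, perm w Q = Q ∨ perm w Q = -Q) {p : SubsetPair n l}
    (hp : p ∈ disjointSubsetPairs k') (h : p.form ∣ Q) : halfProd k' ∣ Q := by
  refine halfProd_dvd hk fun q hq => ?_
  obtain ⟨w, hw⟩ := SubsetPair.exists_perm_form_eq hp hq
  have := map_dvd (perm w) h
  rw [hw] at this
  rcases hQ w with e | e
  · rwa [e] at this
  · rwa [e, dvd_neg] at this

/-- If $\tau V=-V$, then $X_{i,a}-X_{i,b}$ divides $V-\tau V=2V$. Being prime, it is associated to
one of the forms, and these determine $k'$. -/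
theorem eq_single_of_perm_halfProd_eq_neg (hk : ∃ i, k' i ≠ 0) {i : Fin l} {a b : Fin n}
    (hab : a ≠ b) (h : perm (Pi.mulSingle i (Equiv.swap a b)) (halfProd k') = -halfProd k') :
    k' = Pi.single i 1 := by
  have hs : ∃ i', (Pi.single i 1 : Fin l → ℕ) i' ≠ 0 := ⟨i, by simp⟩
  have hd := sub_dvd_sub_perm_swap i a b (halfProd k')
  have h2 : IsUnit (C 2 : EigPoly n l) := (isUnit_iff_ne_zero.2 two_ne_zero).map C
  have e : (halfProd k' - -halfProd k' : EigPoly n l) = C 2 * halfProd k' := by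
    rw [show (C 2 : EigPoly n l) = 2 from map_ofNat C 2]; ring
  have hprime := SubsetPair.prime_form (SubsetPair.single_mem i hab) hs
  rw [h, e, h2.dvd_mul_left, ← SubsetPair.form_single] at hd
  have hd' : (SubsetPair.single i a b).form ∣ pairProd k' := by
    rw [pairProd_eq_halfProd_sq hk]
    exact hd.trans (dvd_pow_self _ two_ne_zero)
  rw [pairProd, hprime.dvd_finsetProd_iff] at hd'
  obtain ⟨q, hq, hq'⟩ := hd'
  exact (SubsetPair.eq_of_form_dvd_form (SubsetPair.single_mem i hab) hq hs hk hq').symm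

theorem isBlockSymm_halfProd (hk : ∃ i, k' i ≠ 0) (h1 : ∑ i, k' i ≠ 1) :
    (halfProd k' : EigPoly n l).IsBlockSymm := by
  refine isBlockSymm_of_swap fun i a b hab => (perm_halfProd hk _).resolve_right fun h => h1 ?_
  rw [eq_single_of_perm_halfProd_eq_neg hk hab h]
  simp

/-- Write $V=(X_{i,a}-X_{i,b})R$. If $V$ were invariant, $R$ would be negated and hence divisible by
$X_{i,a}-X_{i,b}$ again, against squarefreeness. -/
theorem perm_halfProd_single {i : Fin l} {a b : Fin n} (hab : a ≠ b) :
    perm (Pi.mulSingle i (Equiv.swap a b)) (halfProd (Pi.single i 1)) =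
      -halfProd (Pi.single i 1) := by
  have hs : ∃ i', (Pi.single i 1 : Fin l → ℕ) i' ≠ 0 := ⟨i, by simp⟩
  have hm := SubsetPair.single_mem i hab
  have hprime := SubsetPair.prime_form hm hs
  refine (perm_halfProd hs _).resolve_left fun h => ?_
  obtain ⟨R, hR⟩ := form_dvd_halfProd hs hm
  have hτ : perm (Pi.mulSingle i (Equiv.swap a b)) (SubsetPair.single i a b).form =
      -(SubsetPair.single i a b).form := by
    rw [SubsetPair.form_single, map_sub, perm_X, perm_X]
    simp
  have hR' : perm (Pi.mulSingle i (Equiv.swap a b)) R = -R := by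
    rw [hR, map_mul, hτ] at h
    refine mul_left_cancel₀ hprime.ne_zero ?_
    rw [mul_neg, ← h]; ring
  have hd := sub_dvd_sub_perm_swap i a b R
  have h2 : IsUnit (C 2 : EigPoly n l) := (isUnit_iff_ne_zero.2 two_ne_zero).map C
  have e : R - -R = C 2 * R := by
    rw [show (C 2 : EigPoly n l) = 2 from map_ofNat C 2]; ring
  rw [hR', e, h2.dvd_mul_left, ← SubsetPair.form_single] at hd
  exact not_form_sq_dvd_halfProd hs hm (hR ▸ mul_dvd_mul_left _ hd)

theorem exists_perm_halfProd_eq_neg (h1 : ∑ i, k' i = 1) (h2 : ∀ i, 2 * k' i ≤ n) :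
    ∃ w : Fin l → Equiv.Perm (Fin n), perm w (halfProd k') = -halfProd k' := by
  obtain ⟨i, hi⟩ : ∃ i, k' i ≠ 0 := by
    by_contra! h
    simp [h] at h1
  have hs : k' = Pi.single i 1 := by
    rw [← Finset.add_sum_erase _ _ (Finset.mem_univ i)] at h1
    have h0 : ∑ x ∈ Finset.univ.erase i, k' x = 0 := by omega
    funext i'
    by_cases h : i' = i
    · subst h
      rw [Pi.single_eq_same]; omega
    · rw [Pi.single_eq_of_ne h]
      exact Finset.sum_eq_zero_iff.1 h0 i' (by simp [h])
  subst hs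
  have hn := h2 i
  rw [Pi.single_eq_same] at hn
  exact ⟨_, perm_halfProd_single (a := ⟨0, by omega⟩) (b := ⟨1, by omega⟩) (by simp)⟩

theorem exists_mem_disjointSubsetPairs (h2 : ∀ i, 2 * k' i ≤ n) :
    ∃ p : SubsetPair n l, p ∈ disjointSubsetPairs k' := by
  have : ∀ i, ∃ q : Finset (Fin n) × Finset (Fin n),
      q.1.card = k' i ∧ q.2.card = k' i ∧ Disjoint q.1 q.2 := by
    intro i
    have hi := h2 i
    obtain ⟨s, -, hs⟩ := Finset.exists_subset_card_eq (s := (Finset.univ : Finset (Fin n)))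
      (n := k' i) (by simp; omega)
    obtain ⟨t, ht, ht'⟩ := Finset.exists_subset_card_eq (s := sᶜ)
      (n := k' i) (by rw [Finset.card_compl, Fintype.card_fin]; omega)
    exact ⟨(s, t), hs, ht', Finset.disjoint_left.2 fun a ha hat => by
      simpa [ha] using ht hat⟩
  choose q hq using this
  exact ⟨(fun i => (q i).1, fun i => (q i).2), mem_disjointSubsetPairs.2 hq⟩

theorem not_isUnit_halfProd (hk : ∃ i, k' i ≠ 0) (h2 : ∀ i, 2 * k' i ≤ n) :
    ¬ IsUnit (halfProd k' : EigPoly n l) := by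
  obtain ⟨p, hp⟩ := exists_mem_disjointSubsetPairs h2
  exact fun h => (SubsetPair.prime_form hp hk).not_isUnit
    (isUnit_of_dvd_unit (form_dvd_halfProd hk hp) h)

/-- The factor containing one prime form contains all of $V$ by transitivity, which leaves a unit
for the other. -/
theorem isUnit_or_isUnit_of_halfProd_eq_mul (hk : ∃ i, k' i ≠ 0) (h2 : ∀ i, 2 * k' i ≤ n)
    {a b : EigPoly n l} (ha : a.IsBlockSymm) (hb : b.IsBlockSymm) (h : halfProd k' = a * b) :
    IsUnit a ∨ IsUnit b := by
  obtain ⟨p, hp⟩ := exists_mem_disjointSubsetPairs h2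
  have key : ∀ a b : EigPoly n l, a.IsBlockSymm → halfProd k' = a * b → p.form ∣ a →
      IsUnit b := by
    intro a b ha h hd
    obtain ⟨c, hc⟩ := halfProd_dvd_of_form_dvd hk (fun w => Or.inl (ha w)) hp hd
    refine IsUnit.of_mul_eq_one c (mul_left_cancel₀ (halfProd_ne_zero (n := n) hk) ?_)
    rw [mul_one, mul_comm b, ← mul_assoc, ← hc, ← h]
  have hd := form_dvd_halfProd hk hp
  rw [h] at hd
  rcases (SubsetPair.prime_form hp hk).dvd_or_dvd hd with hd | hd
  · exact Or.inr (key a b ha h hd)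
  · exact Or.inl (key b a hb (by rw [h, mul_comm]) hd)

/-- A symmetric factor containing one form is $a=Vc$, and then $V=cb$. Here $c$ is symmetric up to
sign, so $V$ divides either $c$, making $b$ a unit, or $b$, making $c$ constant. -/
theorem isUnit_or_isUnit_of_pairProd_eq_mul (h1 : ∑ i, k' i = 1) (hk : ∃ i, k' i ≠ 0)
    (h2 : ∀ i, 2 * k' i ≤ n) {a b : EigPoly n l} (ha : a.IsBlockSymm) (hb : b.IsBlockSymm)
    (h : pairProd k' = a * b) : IsUnit a ∨ IsUnit b := by
  obtain ⟨p, hp⟩ := exists_mem_disjointSubsetPairs h2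
  obtain ⟨w₀, hw₀⟩ := exists_perm_halfProd_eq_neg h1 h2
  have hprime := SubsetPair.prime_form hp hk
  have hV := halfProd_ne_zero (n := n) hk
  have key : ∀ a b : EigPoly n l, a.IsBlockSymm → b.IsBlockSymm → pairProd k' = a * b →
      p.form ∣ a → IsUnit b := by
    intro a b ha hb h hd
    obtain ⟨c, hc⟩ := halfProd_dvd_of_form_dvd hk (fun w => Or.inl (ha w)) hp hd
    have hcb : halfProd k' = c * b := by
      refine mul_left_cancel₀ hV ?_
      rw [← mul_assoc, ← hc, ← h, pairProd_eq_halfProd_sq hk, sq]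
    have hsc : ∀ w, perm w c = c ∨ perm w c = -c := by
      intro w
      have := ha w
      rw [hc, map_mul] at this
      rcases perm_halfProd hk w with e | e
      · rw [e] at this
        exact Or.inl (mul_left_cancel₀ hV this)
      · rw [e, neg_mul, ← mul_neg] at this
        exact Or.inr (neg_eq_iff_eq_neg.1 (mul_left_cancel₀ hV this))
    have hd' := form_dvd_halfProd hk hp
    rw [hcb] at hd'
    rcases hprime.dvd_or_dvd hd' with hd' | hd'
    · obtain ⟨e, he⟩ := halfProd_dvd_of_form_dvd hk hsc hp hd'
      refine IsUnit.of_mul_eq_one e (mul_left_cancel₀ hV ?_)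
      rw [mul_one, mul_comm b, ← mul_assoc, ← he, ← hcb]
    · exfalso
      obtain ⟨e, he⟩ := halfProd_dvd_of_form_dvd hk (fun w => Or.inl (hb w)) hp hd'
      have hcu : IsUnit c := by
        refine IsUnit.of_mul_eq_one e (mul_left_cancel₀ hV ?_)
        rw [mul_one, mul_left_comm, ← he, ← hcb]
      obtain ⟨r, hr, rfl⟩ := MvPolynomial.isUnit_iff_eq_C_of_isReduced.1 hcu
      -- Now $a$ is a nonzero scalar multiple of $V$; this contradicts its symmetry, as `w₀` negates
      -- $V$.
      have h3 := ha w₀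
      have hr' : perm w₀ (C r) = (C r : EigPoly n l) := by simp [perm]
      rw [hc, map_mul, hw₀, hr', neg_mul, neg_eq_self] at h3
      exact mul_ne_zero hV hcu.ne_zero h3
  have hd : p.form ∣ a * b := by
    rw [← h]
    exact Finset.dvd_prod_of_mem _ hp
  rcases hprime.dvd_or_dvd hd with hd | hd
  · exact Or.inr (key a b ha hb h hd)
  · exact Or.inl (key b a hb ha (by rw [h, mul_comm]) hd)

end EigPoly

/-! ### Irreducibility and distinctness in the matrix entries -/

theorem isSmallD_iff_isLift {n l : ℕ} {k' : Fin l → ℕ} {d : EntryPoly n l} :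
    IsSmallD k' d ↔ d.IsLift (EigPoly.pairProd k') := by
  simp only [IsSmallD, EntryPoly.IsLift, EigPoly.eval_pairProd]

theorem IsSmallD.irreducible {n l : ℕ} {k' : Fin l → ℕ} {d : EntryPoly n l} (hd : IsSmallD k' d)
    (hk : ∃ i, k' i ≠ 0) (h2 : ∀ i, 2 * k' i ≤ n) (h1 : ∑ i, k' i = 1) : Irreducible d := by
  have hV := EigPoly.pairProd_eq_halfProd_sq (n := n) hk
  refine (isSmallD_iff_isLift.1 hd).irreducible ?_ ?_ fun a b ha hb h =>
    EigPoly.isUnit_or_isUnit_of_pairProd_eq_mul h1 hk h2 ha hb h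
  · rw [hV]
    exact pow_ne_zero 2 (EigPoly.halfProd_ne_zero hk)
  · rw [hV, isUnit_pow_iff two_ne_zero]
    exact EigPoly.not_isUnit_halfProd hk h2

theorem IsSmallD.exists_irreducible_sq {n l : ℕ} {k' : Fin l → ℕ} {d : EntryPoly n l}
    (hd : IsSmallD k' d) (hk : ∃ i, k' i ≠ 0) (h2 : ∀ i, 2 * k' i ≤ n) (h1 : ∑ i, k' i ≠ 1) :
    ∃ D : EntryPoly n l, Irreducible D ∧ d = D ^ 2 := by
  obtain ⟨D, hD⟩ := (EigPoly.isBlockSymm_halfProd (n := n) hk h1).exists_entryPoly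
  have hD : D.IsLift _ := hD
  refine ⟨D, hD.irreducible (EigPoly.halfProd_ne_zero hk) (EigPoly.not_isUnit_halfProd hk h2)
    fun a b ha hb h => EigPoly.isUnit_or_isUnit_of_halfProd_eq_mul hk h2 ha hb h, ?_⟩
  refine (isSmallD_iff_isLift.1 hd).unique fun A μ h => ?_
  rw [EigPoly.pairProd_eq_halfProd_sq hk, map_pow, ← hD A μ h, sq, EntryPoly.evalAt_mul, sq]

theorem IsBigD.irreducible {n l : ℕ} {k' : Fin l → ℕ} {D : EntryPoly n l} (hD : IsBigD k' D)
    (hk : ∃ i, k' i ≠ 0) (h2 : ∀ i, 2 * k' i ≤ n) : Irreducible D := by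
  obtain ⟨d, hd, ⟨h1, rfl⟩ | ⟨h1, h⟩⟩ := hD
  · exact hd.irreducible hk h2 h1
  · obtain ⟨D', hD', h'⟩ := hd.exists_irreducible_sq hk h2 h1
    rcases sq_eq_sq_iff_eq_or_eq_neg.1 (h.trans h') with rfl | rfl
    · exact hD'
    · exact (Associated.refl D').neg_left.symm.irreducible hD'

theorem IsBigD.dvd_pairProd {n l : ℕ} {k' : Fin l → ℕ} {D : EntryPoly n l} (hD : IsBigD k' D) :
    EntryPoly.diag n l D ∣ EigPoly.pairProd k' := by
  obtain ⟨d, hd, h⟩ := hD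
  rw [← (isSmallD_iff_isLift.1 hd).diag_eq]
  refine map_dvd _ ?_
  rcases h with ⟨-, rfl⟩ | ⟨-, rfl⟩
  · exact dvd_rfl
  · exact dvd_pow_self _ two_ne_zero

theorem IsBigD.form_dvd {n l : ℕ} {k' : Fin l → ℕ} {D : EntryPoly n l} (hD : IsBigD k' D)
    (hk : ∃ i, k' i ≠ 0) {p : SubsetPair n l} (hp : p ∈ disjointSubsetPairs k') :
    p.form ∣ EntryPoly.diag n l D := by
  obtain ⟨d, hd, h⟩ := hD
  have hdvd : p.form ∣ EntryPoly.diag n l d := by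
    rw [(isSmallD_iff_isLift.1 hd).diag_eq]
    exact Finset.dvd_prod_of_mem _ hp
  rcases h with ⟨-, rfl⟩ | ⟨-, rfl⟩
  · exact hdvd
  · rw [map_pow] at hdvd
    exact (SubsetPair.prime_form hp hk).dvd_of_dvd_pow hdvd

/-- On diagonal matrices a form for $k'$ divides $D'$, hence $D''$ and the product of the forms for
$k''$; being prime, it divides one of them. -/
theorem IsBigD.eq_of_associated {n l : ℕ} {k' k'' : Fin l → ℕ} {D' D'' : EntryPoly n l}
    (hD' : IsBigD k' D') (hD'' : IsBigD k'' D'') (hk' : ∃ i, k' i ≠ 0) (hk'' : ∃ i, k'' i ≠ 0)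
    (h2 : ∀ i, 2 * k' i ≤ n) (h : Associated D' D'') : k' = k'' := by
  obtain ⟨p, hp⟩ := EigPoly.exists_mem_disjointSubsetPairs h2
  have hd := ((hD'.form_dvd hk' hp).trans (map_dvd _ h.dvd)).trans hD''.dvd_pairProd
  rw [EigPoly.pairProd, (SubsetPair.prime_form hp hk').dvd_finsetProd_iff] at hd
  obtain ⟨q, hq, hpq⟩ := hd
  exact SubsetPair.eq_of_form_dvd_form hp hq hk' hk'' hpq

theorem mainTheorem6 (n l : ℕ) (k : Fin l → ℕ) (hk : ∑ i, k i = n) :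
    (∀ k' : Fin l → ℕ, (∀ i, k' i ≤ k i) → (∃ i, k' i ≠ 0) →
      ∃ d : EntryPoly n l,
        IsSmallD k' d ∧ (∀ d' : EntryPoly n l, IsSmallD k' d' → d' = d) ∧
        d.IsConjInvariant ∧
        ((∀ i, 2 * k' i ≤ n) →
          (∑ i, k' i = 1 → Irreducible d) ∧
          (∑ i, k' i ≠ 1 → ∃ D : EntryPoly n l, Irreducible D ∧ d = D ^ 2))) ∧
    (∀ k' k'' : Fin l → ℕ,
      (∀ i, k' i ≤ k i) → (∃ i, k' i ≠ 0) → (∀ i, 2 * k' i ≤ n) →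
      (∀ i, k'' i ≤ k i) → (∃ i, k'' i ≠ 0) → (∀ i, 2 * k'' i ≤ n) →
      k' ≠ k'' →
      ∀ D' D'' : EntryPoly n l, IsBigD k' D' → IsBigD k'' D'' →
        Irreducible D' ∧ Irreducible D'' ∧ ¬ Associated D' D'') := by
  refine ⟨fun k' _ hk' => ?_, fun k' k'' _ hk' h2' _ hk'' h2'' hne D' D'' hD' hD'' =>
    ⟨hD'.irreducible hk' h2', hD''.irreducible hk'' h2'',
      fun h => hne (hD'.eq_of_associated hD'' hk' hk'' h2' h)⟩⟩
  obtain ⟨d, hd⟩ := (EigPoly.isBlockSymm_pairProd (n := n) (k' := k')).exists_entryPoly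
  have hlift : d.IsLift (EigPoly.pairProd k') := hd
  have hsmall : IsSmallD k' d := isSmallD_iff_isLift.2 hlift
  exact ⟨d, hsmall, fun d' hd' => (isSmallD_iff_isLift.1 hd').unique hlift,
    hlift.isConjInvariant, fun h2 => ⟨hsmall.irreducible hk' h2,
      hsmall.exists_irreducible_sq hk' h2⟩⟩
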